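/- Let $N$ be a natural number, $\alpha_1,\dots,\alpha_N\in\mathbb{R}$, $0<\Omega<\pi$ and $\gamma\ge 0$. Let $R(z)=\sum_{k=1}^{N}\alpha_k z^{-k}$, and let $$A=\begin{bmatrix}0&1&&0\\&\ddots&\ddots&\\&&\ddots&1\\0&&&0\end{bmatrix}\in\mathbb{R}^{N\times N},\qquad B=\begin{bmatrix}0\\\vdots\\0\\1\end{bmatrix}\in\mathbb{R}^{N\times 1},\qquad C(\alpha)=[\alpha_N,\alpha_{N-1},\dots,\alpha_1]\in\mathbb{R}^{1\times N}.$$ For real symmetric $N\times N$ matrices $X,Y$ put $$M_1(X,Y)=A^\top XA+YA+A^\top Y-X-2Y\cos\Omega,\quad M_2(X,Y)=A^\top XB+YB,\quad M_3(X,\gamma^2)=B^\top XB-\gamma^2.$$ Then $$\max_{\omega\in[0,\Omega]}\left|1+R(e^{\mathrm{j}\omega})\right|<\gamma$$ if and only if there exist real symmetric $N\times N$ matrices $X$ and $Y$, with $Y$ positive definite, such that the symmetric matrix $$\begin{bmatrix}M_1(X,Y)&M_2(X,Y)&C(\alpha)^\top\\M_2(X,Y)^\top&M_3(X,\gamma^2)&1\\C(\alpha)&1&-1\end{bmatrix}$$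 is negative definite. -/

import Mathlib

namespace DeltaSigma

open Matrix

noncomputable section

/-- The FIR filter `R(z) = ∑_{k=0}^{N} α_k z^{-k}` with real coefficients `α = [α_0, …, α_N]`. -/
def firFilter {N : ℕ} (α : Fin (N + 1) → ℝ) (z : ℂ) : ℂ :=
  ∑ k : Fin (N + 1), (α k : ℂ) * z ^ (-((k : ℕ) : ℤ))

/-- The `N × N` shift matrix: ones on the first superdiagonal, zeros elsewhere. -/
def matA (N : ℕ) : Matrix (Fin N) (Fin N) ℝ :=
  Matrix.of fun i j => if (i : ℕ) + 1 = (j : ℕ) then 1 else 0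

/-- The column `[0, …, 0, 1]ᵀ` of length `N`. -/
def matB (N : ℕ) : Matrix (Fin N) (Fin 1) ℝ :=
  Matrix.of fun i _ => if (i : ℕ) + 1 = N then 1 else 0

/-- The row `C(α) = [α_N, α_{N-1}, …, α_1]`; its entry in (zero-based) position `i` is
`α_{N-i}`. -/
def matC {N : ℕ} (α : Fin (N + 1) → ℝ) : Matrix (Fin 1) (Fin N) ℝ :=
  Matrix.of fun _ i => α (Fin.rev i.castSucc)

/-- `M₁(X, Y) = Aᵀ X A + Y A + Aᵀ Y - X - 2 Y cos Ω`. -/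
def M1 {N : ℕ} (Ω : ℝ) (X Y : Matrix (Fin N) (Fin N) ℝ) : Matrix (Fin N) (Fin N) ℝ :=
  (matA N)ᵀ * X * matA N + Y * matA N + (matA N)ᵀ * Y - X - (2 * Real.cos Ω) • Y

/-- `M₂(X, Y) = Aᵀ X B + Y B`. -/
def M2 {N : ℕ} (X Y : Matrix (Fin N) (Fin N) ℝ) : Matrix (Fin N) (Fin 1) ℝ :=
  (matA N)ᵀ * X * matB N + Y * matB N

/-- `M₃(X, g) = Bᵀ X B - g`, a `1 × 1` matrix (used with `g = γ²`). -/
def M3 {N : ℕ} (X : Matrix (Fin N) (Fin N) ℝ) (g : ℝ) : Matrix (Fin 1) (Fin 1) ℝ :=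
  (matB N)ᵀ * X * matB N - g • (1 : Matrix (Fin 1) (Fin 1) ℝ)

/-- The symmetric `3 × 3` block matrix
`[M₁(X,Y), M₂(X,Y), C(α)ᵀ; M₂(X,Y)ᵀ, M₃(X,γ²), 1; C(α), 1, -1]`. -/
def lmiMatrix {N : ℕ} (α : Fin (N + 1) → ℝ) (Ω γ : ℝ) (X Y : Matrix (Fin N) (Fin N) ℝ) :
    Matrix ((Fin N ⊕ Fin 1) ⊕ Fin 1) ((Fin N ⊕ Fin 1) ⊕ Fin 1) ℝ :=
  Matrix.fromBlocks
    (Matrix.fromBlocks (M1 Ω X Y) (M2 X Y) (M2 X Y)ᵀ (M3 X (γ ^ 2)))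
    (Matrix.fromRows (matC α)ᵀ 1)
    (Matrix.fromCols (matC α) 1)
    (-1)

/-- `F < 0` for a real square matrix: `F` is symmetric and negative definite. -/
def NegDef {n : Type*} (F : Matrix n n ℝ) : Prop :=
  (-F).PosDef

end

end DeltaSigma

namespace DeltaSigma

open Matrix Polynomial

noncomputable section

/-! Completing the square in the last variable (a Schur complement) turns the LMI into negativity of
a form on `ℝ^(N+1)` built from `X`, `Y` and `gainMatrix`. Its cosine polynomial decides everything:
the `X` part, a difference of two shifted copies, contributes zero; the `Y` part contributes `(2 cos
ω - 2 cos Ω)` times that of `Y`; `gainMatrix` gives `γ² - |1 + R|²`. Evaluating on `[0, Ω]`, where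
the weight is nonnegative, yields the bound.

Conversely, `γ² - |1 + R|²` is a polynomial in `cos ω`, positive on `[cos Ω, 1]`. By
`isIntervalSOS_of_pos_on_Icc` it is a sum of squares plus the weight times another one. Gram
matrices of the two, made definite by a small multiple of the identity, give `P` and `Y`. Then
`gainMatrix - P - bandMatrix` has zero cosine polynomial, and `exists_displacement` realises it as
the `X` part, so that the whole form equals `-P`. -/

/-- The cosine polynomial `ω ↦ v(ω)ᴴ M v(ω)` of a real matrix `M`, where
`v(ω)ₖ = exp (j k ω)`. -/
def trigForm {n : ℕ} (M : Matrix (Fin n) (Fin n) ℝ) (ω : ℝ) : ℝ :=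
  ∑ i, ∑ j, M i j * Real.cos (((i : ℝ) - (j : ℝ)) * ω)

/-! ### Cosine polynomials of matrices -/

section trigForm

variable {n : ℕ}

theorem trigForm_add (M M' : Matrix (Fin n) (Fin n) ℝ) (ω : ℝ) :
    trigForm (M + M') ω = trigForm M ω + trigForm M' ω := by
  simp [trigForm, add_mul, Finset.sum_add_distrib]

theorem trigForm_sub (M M' : Matrix (Fin n) (Fin n) ℝ) (ω : ℝ) :
    trigForm (M - M') ω = trigForm M ω - trigForm M' ω := by
  simp [trigForm, sub_mul, Finset.sum_sub_distrib]

theorem trigForm_smul (a : ℝ) (M : Matrix (Fin n) (Fin n) ℝ) (ω : ℝ) :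
    trigForm (a • M) ω = a * trigForm M ω := by
  simp [trigForm, Finset.mul_sum, mul_assoc]

theorem trigForm_one (ω : ℝ) : trigForm (1 : Matrix (Fin n) (Fin n) ℝ) ω = n := by
  simp [trigForm, Matrix.one_apply]

theorem trigForm_eq_quadratic (M : Matrix (Fin n) (Fin n) ℝ) (ω : ℝ) :
    trigForm M ω =
      (fun k : Fin n => Real.cos (k * ω)) ⬝ᵥ M *ᵥ (fun k : Fin n => Real.cos (k * ω)) +
      (fun k : Fin n => Real.sin (k * ω)) ⬝ᵥ M *ᵥ (fun k : Fin n => Real.sin (k * ω)) := by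
  simp only [trigForm, dotProduct, mulVec, Finset.mul_sum, ← Finset.sum_add_distrib]
  refine Finset.sum_congr rfl fun i _ => Finset.sum_congr rfl fun j _ => ?_
  rw [sub_mul, Real.cos_sub]; ring

theorem trigForm_vecMulVec (a : Fin n → ℝ) (ω : ℝ) :
    trigForm (vecMulVec a a) ω =
      (∑ k, a k * Real.cos (k * ω)) ^ 2 + (∑ k, a k * Real.sin (k * ω)) ^ 2 := by
  rw [sq, sq, Finset.sum_mul_sum, Finset.sum_mul_sum, ← Finset.sum_add_distrib, trigForm]
  refine Finset.sum_congr rfl fun i _ => ?_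
  rw [← Finset.sum_add_distrib]
  refine Finset.sum_congr rfl fun j _ => ?_
  rw [sub_mul, Real.cos_sub, vecMulVec_apply]; ring

theorem normSq_sum_exp (a : Fin n → ℝ) (ω : ℝ) :
    ‖∑ k, (a k : ℂ) * Complex.exp (ω * Complex.I) ^ (k : ℕ)‖ ^ 2 = trigForm (vecMulVec a a) ω := by
  have h : ∀ k : Fin n, Complex.exp (ω * Complex.I) ^ (k : ℕ) =
      Real.cos (k * ω) + Real.sin (k * ω) * Complex.I := fun k => by
    rw [← Complex.exp_nat_mul, ← mul_assoc, Complex.exp_mul_I]; push_cast; rfl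
  rw [trigForm_vecMulVec, ← Complex.normSq_eq_norm_sq, Complex.normSq_apply, sq, sq]
  simp only [h, Complex.re_sum, Complex.im_sum, Complex.mul_re, Complex.mul_im, Complex.add_re,
    Complex.add_im, Complex.ofReal_re, Complex.ofReal_im, Complex.I_re, Complex.I_im]
  simp

/-- Every cosine polynomial is a polynomial in `cos ω`. -/
theorem exists_polynomial_trigForm {N : ℕ} (M : Matrix (Fin (N + 1)) (Fin (N + 1)) ℝ) :
    ∃ p : ℝ[X], p.degree ≤ N ∧ ∀ ω, trigForm M ω = p.eval (Real.cos ω) := by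
  -- `cos (kω) = T_k (cos ω)`, with Chebyshev indices in `ℤ` so that the sign of `i - j` needs no
  -- cases.
  refine ⟨∑ i, ∑ j, C (M i j) * Chebyshev.T ℝ ((i : ℤ) - (j : ℤ)), ?_, fun ω => ?_⟩
  · refine (degree_sum_le _ _).trans (Finset.sup_le fun i _ => (degree_sum_le _ _).trans
      (Finset.sup_le fun j _ => ?_))
    rw [← smul_eq_C_mul]
    refine (degree_smul_le _ _).trans ?_
    rw [Chebyshev.degree_T]
    have := i.2; have := j.2
    exact_mod_cast (by omega : ((i : ℤ) - (j : ℤ)).natAbs ≤ N)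
  · simp [trigForm, eval_finsetSum]

end trigForm

/-! ### Sums of squares on the unit circle -/

/-- The cone of sums of squares `‖h (exp (j ω))‖²` with `h` a real polynomial of degree less
than `n`. -/
def sosCone (n : ℕ) : AddSubmonoid (ℝ → ℝ) :=
  AddSubmonoid.closure
    {f | ∃ h : ℝ[X], h.degree < n ∧ f = fun ω : ℝ => ‖aeval (Complex.exp (ω * Complex.I)) h‖ ^ 2}

theorem sosCone_mono : Monotone sosCone := fun _ _ hmn =>
  AddSubmonoid.closure_mono fun _ ⟨h, hd, hf⟩ => ⟨h, hd.trans_le (by exact_mod_cast hmn), hf⟩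

theorem normSq_mul_mem_sosCone {n d : ℕ} {f : ℝ → ℝ} (hf : f ∈ sosCone n) {g : ℝ[X]}
    (hg : g.degree ≤ d) :
    (fun ω : ℝ => ‖aeval (Complex.exp (ω * Complex.I)) g‖ ^ 2 * f ω) ∈ sosCone (n + d) := by
  induction hf using AddSubmonoid.closure_induction with
  | mem f hf =>
    obtain ⟨h, hd, rfl⟩ := hf
    refine AddSubmonoid.subset_closure ⟨g * h, ?_, ?_⟩
    · rw [degree_mul]
      by_cases h0 : h = 0
      · simp [h0, bot_lt_iff_ne_bot]
      by_cases g0 : g = 0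
      · simp [g0, bot_lt_iff_ne_bot]
      rw [degree_eq_natDegree h0] at hd ⊢
      rw [degree_eq_natDegree g0] at hg ⊢
      norm_cast at *
      omega
    · ext ω; simp [mul_pow]
  | zero => simp [← Pi.zero_def]
  | add f f' _ _ h h' =>
    convert (sosCone (n + d)).add_mem h h' using 1
    ext ω; simp [mul_add]

theorem const_mul_mem_sosCone {n : ℕ} {f : ℝ → ℝ} (hf : f ∈ sosCone n) {a : ℝ} (ha : 0 ≤ a) :
    (fun ω => a * f ω) ∈ sosCone n := by
  have := normSq_mul_mem_sosCone (d := 0) hf (g := C (√a)) degree_C_le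
  simpa [sq_abs, Real.sq_sqrt ha] using this

theorem exists_posSemidef_of_mem_sosCone {n : ℕ} {f : ℝ → ℝ} (hf : f ∈ sosCone n) :
    ∃ P : Matrix (Fin n) (Fin n) ℝ, P.PosSemidef ∧ ∀ ω, f ω = trigForm P ω := by
  induction hf using AddSubmonoid.closure_induction with
  | mem f hf =>
    obtain ⟨h, hd, rfl⟩ := hf
    refine ⟨vecMulVec (fun k => h.coeff k) (fun k => h.coeff k), ?_, fun ω => ?_⟩
    · simpa using posSemidef_vecMulVec_self_star (fun k : Fin n => h.coeff k)
    · rw [← normSq_sum_exp]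
      beta_reduce
      by_cases h0 : h = 0
      · simp [h0]
      rw [aeval_eq_sum_range' ((natDegree_lt_iff_degree_lt h0).2 hd), Finset.sum_range]
      simp
  | zero => exact ⟨0, PosSemidef.zero, fun ω => by simp [trigForm]⟩
  | add f f' _ _ h h' =>
    obtain ⟨P, hP, h⟩ := h
    obtain ⟨P', hP', h'⟩ := h'
    exact ⟨P + P', hP.add hP', fun ω => by simp [trigForm_add, h, h']⟩

theorem normSq_aeval_one_sub_X (ω : ℝ) :
    ‖aeval (Complex.exp (ω * Complex.I)) (1 - X : ℝ[X])‖ ^ 2 = 2 * (1 - Real.cos ω) := by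
  rw [← Complex.normSq_eq_norm_sq, Complex.normSq_apply, Complex.exp_mul_I, ← Complex.ofReal_cos,
    ← Complex.ofReal_sin]
  simp [-Complex.ofReal_cos, -Complex.ofReal_sin]
  linear_combination Real.sin_sq_add_cos_sq ω

theorem normSq_aeval_quadratic (a ω : ℝ) :
    ‖aeval (Complex.exp (ω * Complex.I)) (X ^ 2 - C (2 * a) * X + 1 : ℝ[X])‖ ^ 2 =
      (2 * Real.cos ω - 2 * a) ^ 2 := by
  rw [← Complex.normSq_eq_norm_sq, Complex.normSq_apply, Complex.exp_mul_I, ← Complex.ofReal_cos,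
    ← Complex.ofReal_sin]
  simp [sq, -Complex.ofReal_cos, -Complex.ofReal_sin]
  have := Real.sin_sq_add_cos_sq ω
  have h : Real.sin ω ^ 2 = 1 - Real.cos ω ^ 2 := by linarith
  ring_nf
  rw [show Real.sin ω ^ 4 = (Real.sin ω ^ 2) ^ 2 by ring, h]
  ring

/-! ### Positive polynomials on an interval -/

/-- `IsIntervalSOS c n f`: the function `f` is a sum of squares plus `2 cos ω - 2 c` times a sum
of squares, of total degree at most `n`. -/
def IsIntervalSOS (c : ℝ) (n : ℕ) (f : ℝ → ℝ) : Prop :=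
  ∃ f₀ ∈ sosCone (n + 1), ∃ f₁ ∈ sosCone n,
    ∀ ω, f ω = f₀ ω + (2 * Real.cos ω - 2 * c) * f₁ ω

namespace IsIntervalSOS

variable {c : ℝ} {n : ℕ} {f g : ℝ → ℝ}

theorem mono (hf : IsIntervalSOS c n f) {m : ℕ} (h : n ≤ m) : IsIntervalSOS c m f :=
  let ⟨f₀, h₀, f₁, h₁, e⟩ := hf
  ⟨f₀, sosCone_mono (by omega) h₀, f₁, sosCone_mono h h₁, e⟩

theorem add (hf : IsIntervalSOS c n f) (hg : IsIntervalSOS c n g) :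
    IsIntervalSOS c n (fun ω => f ω + g ω) := by
  obtain ⟨f₀, h₀, f₁, h₁, e⟩ := hf
  obtain ⟨g₀, h₀', g₁, h₁', e'⟩ := hg
  refine ⟨f₀ + g₀, add_mem h₀ h₀', f₁ + g₁, add_mem h₁ h₁', fun ω => ?_⟩
  simp only [e, e', Pi.add_apply]; ring

theorem normSq_mul (hf : IsIntervalSOS c n f) {d : ℕ} {q : ℝ[X]} (hq : q.degree ≤ d) :
    IsIntervalSOS c (n + d)
      (fun ω => ‖aeval (Complex.exp (ω * Complex.I)) q‖ ^ 2 * f ω) := by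
  obtain ⟨f₀, h₀, f₁, h₁, e⟩ := hf
  refine ⟨_, sosCone_mono (by omega) (normSq_mul_mem_sosCone h₀ hq), _,
    normSq_mul_mem_sosCone h₁ hq, fun ω => ?_⟩
  simp only [e]; ring

theorem const_mul (hf : IsIntervalSOS c n f) {a : ℝ} (ha : 0 ≤ a) :
    IsIntervalSOS c n (fun ω => a * f ω) := by
  obtain ⟨f₀, h₀, f₁, h₁, e⟩ := hf
  refine ⟨_, const_mul_mem_sosCone h₀ ha, _, const_mul_mem_sosCone h₁ ha, fun ω => ?_⟩
  simp only [e]; ring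

theorem const {a : ℝ} (ha : 0 ≤ a) : IsIntervalSOS c 0 (fun _ => a) := by
  refine ⟨_, AddSubmonoid.subset_closure ⟨C √a, degree_C_le.trans_lt (by simp), rfl⟩, 0,
    zero_mem _, fun ω => ?_⟩
  simp [Real.sq_sqrt ha]

theorem mul_one_sub_cos (hf : IsIntervalSOS c n f) :
    IsIntervalSOS c (n + 1) (fun ω => (1 - Real.cos ω) * f ω) := by
  have hd : (1 - X : ℝ[X]).degree ≤ (1 : ℕ) := by compute_degree; norm_num
  convert (hf.normSq_mul hd).const_mul (a := 1 / 2) (by norm_num) using 2 with ω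
  rw [normSq_aeval_one_sub_X]; ring

theorem mul_cos_sub_sq (hf : IsIntervalSOS c n f) (a : ℝ) :
    IsIntervalSOS c (n + 2) (fun ω => (Real.cos ω - a) ^ 2 * f ω) := by
  have hd : (X ^ 2 - C (2 * a) * X + 1 : ℝ[X]).degree ≤ (2 : ℕ) := by compute_degree; norm_num
  convert (hf.normSq_mul hd).const_mul (a := 1 / 4) (by norm_num) using 2 with ω
  rw [normSq_aeval_quadratic]; ring

/-- The weight exchanges the two summands: `f₀` becomes the weighted part, while `f₁` picks up the
squared weight, itself a squared modulus of degree two. Hence the degree grows by only one. -/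
theorem mul_cos_sub (hf : IsIntervalSOS c n f) :
    IsIntervalSOS c (n + 1) (fun ω => (Real.cos ω - c) * f ω) := by
  obtain ⟨f₀, h₀, f₁, h₁, e⟩ := hf
  have hd : (X ^ 2 - C (2 * c) * X + 1 : ℝ[X]).degree ≤ (2 : ℕ) := by compute_degree; norm_num
  refine ⟨_, const_mul_mem_sosCone (normSq_mul_mem_sosCone h₁ hd) (a := 1 / 2) (by norm_num), _,
    const_mul_mem_sosCone h₀ (a := 1 / 2) (by norm_num), fun ω => ?_⟩
  simp only [e, normSq_aeval_quadratic]; ring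

end IsIntervalSOS

/-- A real polynomial of degree at most `n` that is positive on `[c, 1]` is, as a function of
`cos ω`, a sum of squares plus `2 cos ω - 2 c` times a sum of squares. -/
theorem isIntervalSOS_of_pos_on_Icc {c : ℝ} (hc : c ≤ 1) (n : ℕ) (p : ℝ[X]) (hn : p.natDegree ≤ n)
    (hp : ∀ t ∈ Set.Icc c 1, 0 < p.eval t) :
    IsIntervalSOS c n (fun ω => p.eval (Real.cos ω)) := by
  induction n using Nat.strong_induction_on generalizing p with
  | _ n ih =>
  have hp1 : 0 < p.eval 1 := hp 1 ⟨hc, le_rfl⟩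
  by_cases hd : p.natDegree = 0
  · rw [eq_C_of_natDegree_eq_zero hd] at hp1 ⊢
    rw [eval_C] at hp1
    simpa using (IsIntervalSOS.const (c := c) hp1.le).mono n.zero_le
  have hp0 : p ≠ 0 := by rintro rfl; simp at hp1
  -- Induction on degree: split off the factor of a complex root and write it as a sum of terms that
  -- preserve the decomposition.
  obtain ⟨z, hz⟩ := IsAlgClosed.exists_aeval_eq_zero ℂ p
    (by rw [degree_eq_natDegree hp0]; exact_mod_cast hd)
  by_cases him : z.im = 0
  · have hroot : p.IsRoot z.re := by
      have : z = (algebraMap ℝ ℂ) z.re := Complex.ext rfl (by simpa using him)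
      rw [this, aeval_algebraMap_apply] at hz
      simpa using hz
    obtain ⟨q, rfl⟩ := dvd_iff_isRoot.2 hroot
    have hq0 : q ≠ 0 := right_ne_zero_of_mul hp0
    rw [natDegree_mul (X_sub_C_ne_zero _) hq0, natDegree_X_sub_C] at hn
    obtain ⟨m, rfl⟩ : ∃ m, n = m + 1 := ⟨n - 1, by omega⟩
    simp only [eval_mul, eval_sub, eval_X, eval_C] at hp ⊢
    -- For a root `r < c`, `t - r = (t - c) + (c - r)`. For `r > 1`, `r - t = (1 - t) + (r - 1)`,
    -- with the sign moved to `-q`.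
    rcases lt_or_ge z.re c with h | h
    · have key := ih m (by omega) q (by omega) fun t ht =>
        (pos_iff_pos_of_mul_pos (hp t ht)).1 (by linarith [ht.1])
      convert key.mul_cos_sub.add ((key.mono m.le_succ).const_mul (sub_nonneg.2 h.le)) using 2
      ring
    · have h1 : 1 < z.re := by
        by_contra! h1
        simpa using hp z.re ⟨h, h1⟩
      have key := ih m (by omega) (-q) (by simpa using (by omega : q.natDegree ≤ m)) fun t ht => by
        rw [eval_neg, neg_pos]
        exact (neg_iff_neg_of_mul_pos (hp t ht)).1 (by linarith [ht.2])
      convert key.mul_one_sub_cos.add ((key.mono m.le_succ).const_mul (sub_nonneg.2 h1.le)) using 2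
      rw [eval_neg]; ring
  · obtain ⟨q, rfl⟩ := p.quadratic_dvd_of_aeval_eq_zero_im_ne_zero hz him
    have hq0 : q ≠ 0 := right_ne_zero_of_mul hp0
    have hdeg : (X ^ 2 - C (2 * z.re) * X + C (‖z‖ ^ 2) : ℝ[X]).natDegree = 2 := by
      compute_degree!
    rw [natDegree_mul (left_ne_zero_of_mul hp0) hq0, hdeg] at hn
    obtain ⟨m, rfl⟩ : ∃ m, n = m + 2 := ⟨n - 2, by omega⟩
    have hfac : ∀ t : ℝ, (X ^ 2 - C (2 * z.re) * X + C (‖z‖ ^ 2) : ℝ[X]).eval t =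
        (t - z.re) ^ 2 + z.im ^ 2 := fun t => by
      simp [← Complex.normSq_eq_norm_sq, Complex.normSq_apply]; ring
    simp only [eval_mul, hfac] at hp ⊢
    have key := ih m (by omega) q (by omega) fun t ht =>
      (pos_iff_pos_of_mul_pos (hp t ht)).1 (by positivity)
    convert (key.mul_cos_sub_sq z.re).add
      ((key.mono (by omega : m ≤ m + 2)).const_mul (sq_nonneg z.im)) using 2
    ring

/-! ### The LMI as a quadratic form -/

section quadratic

variable {N : ℕ}

/-- The state equation of a shift register: the next state drops the oldest entry and appends the
input. -/
theorem matA_mulVec_init_add_matB_mulVec_last (w : Fin (N + 1) → ℝ) :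
    matA N *ᵥ Fin.init w + matB N *ᵥ (fun _ => w (Fin.last N)) = Fin.tail w := by
  ext i
  simp only [Pi.add_apply, mulVec, dotProduct, matA, matB, of_apply, ite_mul, one_mul, zero_mul,
    Fin.tail, Fin.init]
  by_cases h : (i : ℕ) + 1 = N
  · rw [Finset.sum_eq_zero fun j _ => if_neg (by omega)]
    simp only [h, if_true, Finset.univ_unique, Finset.sum_singleton, zero_add]
    exact congrArg w (Fin.ext h.symm)
  · rw [Finset.sum_eq_single ⟨i + 1, by omega⟩]
    · simp only [h, if_true, if_false, Finset.sum_const_zero, add_zero]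
      exact congrArg w (Fin.ext rfl)
    · intro j _ hj
      exact if_neg fun e => hj (Fin.ext e.symm)
    · simp

/-- The coefficients of `1 + C(α) (z - A)⁻¹ B`, i.e. of the row `[C(α), 1]`. -/
def augCoeff (α : Fin (N + 1) → ℝ) : Fin (N + 1) → ℝ :=
  Fin.snoc (fun i => α (Fin.rev i.castSucc)) 1

theorem augCoeff_dotProduct (α w : Fin (N + 1) → ℝ) :
    augCoeff α ⬝ᵥ w = matC α 0 ⬝ᵥ Fin.init w + w (Fin.last N) := by
  simp [dotProduct, Fin.sum_univ_castSucc, augCoeff, matC, Fin.init]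

theorem dotProduct_lmiMatrix_mulVec (α : Fin (N + 1) → ℝ) (Ω γ : ℝ)
    {X Y : Matrix (Fin N) (Fin N) ℝ} (hX : X.IsSymm) (hY : Y.IsSymm)
    (w : Fin (N + 1) → ℝ) (t : ℝ) :
    Sum.elim (Sum.elim (Fin.init w) fun _ => w (Fin.last N)) (fun _ => t) ⬝ᵥ
      lmiMatrix α Ω γ X Y *ᵥ
        Sum.elim (Sum.elim (Fin.init w) fun _ => w (Fin.last N)) (fun _ => t) =
    Fin.tail w ⬝ᵥ X *ᵥ Fin.tail w - Fin.init w ⬝ᵥ X *ᵥ Fin.init w +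
      2 * (Fin.tail w ⬝ᵥ Y *ᵥ Fin.init w) -
      2 * Real.cos Ω * (Fin.init w ⬝ᵥ Y *ᵥ Fin.init w) - γ ^ 2 * w (Fin.last N) ^ 2 +
      (augCoeff α ⬝ᵥ w) ^ 2 - (t - augCoeff α ⬝ᵥ w) ^ 2 := by
  have hF := matA_mulVec_init_add_matB_mulVec_last w
  have hc := augCoeff_dotProduct α w
  set u := Fin.init w
  set s : Fin 1 → ℝ := fun _ => w (Fin.last N) with hs
  have hs0 : w (Fin.last N) = s 0 := rfl
  have hcomm : ∀ {Z : Matrix (Fin N) (Fin N) ℝ}, Z.IsSymm → ∀ a b : Fin N → ℝ,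
      a ⬝ᵥ Z *ᵥ b = b ⬝ᵥ Z *ᵥ a := fun {Z} hZ a b => by
    rw [dotProduct_mulVec, ← mulVec_transpose, hZ.eq, dotProduct_comm]
  rw [← hF, hc, hs0]
  have ht : ∀ {m n : Type} [Fintype m] [Fintype n] (K : Matrix m n ℝ) (a : n → ℝ) (b : m → ℝ),
      a ⬝ᵥ Kᵀ *ᵥ b = (K *ᵥ a) ⬝ᵥ b := fun K a b => by
    rw [dotProduct_mulVec, vecMul_transpose]
  have hM2 : s ⬝ᵥ (M2 X Y)ᵀ *ᵥ u = u ⬝ᵥ M2 X Y *ᵥ s := by rw [ht, dotProduct_comm]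
  simp only [lmiMatrix, fromBlocks_mulVec, Sum.elim_comp_inl, Sum.elim_comp_inr,
    sumElim_dotProduct_sumElim, fromRows_mulVec, fromCols_mulVec, dotProduct_add, hM2,
    add_dotProduct, Sum.elim_add_add]
  simp only [M1, M2, M3, add_mulVec, sub_mulVec, dotProduct_add, dotProduct_sub, ← mulVec_mulVec,
    ht, smul_mulVec, dotProduct_smul, smul_eq_mul, one_mulVec, neg_mulVec, dotProduct_neg,
    mulVec_add]
  have h1 : ∀ a b : Fin 1 → ℝ, a ⬝ᵥ b = a 0 * b 0 := fun a b => by simp [dotProduct]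
  have h2 : (matC α *ᵥ u) 0 = matC α 0 ⬝ᵥ u := rfl
  rw [hcomm hX (matB N *ᵥ s) (matA N *ᵥ u), hcomm hY (matA N *ᵥ u) u,
    hcomm hY (matB N *ᵥ s) u, h1 (fun _ => t) (matC α *ᵥ u), h1 (matC α *ᵥ u), h1 s s,
    h1 (fun _ => t) s, h1 s, h1 (fun _ => t), h2]
  ring

theorem isSymm_lmiMatrix (α : Fin (N + 1) → ℝ) (Ω γ : ℝ)
    {X Y : Matrix (Fin N) (Fin N) ℝ} (hX : X.IsSymm) (hY : Y.IsSymm) :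
    (lmiMatrix α Ω γ X Y).IsSymm := by
  refine IsSymm.fromBlocks (IsSymm.fromBlocks ?_ rfl ?_) ?_ (by simp [IsSymm])
  · simp only [IsSymm, M1, transpose_sub, transpose_add, transpose_mul, transpose_smul,
      transpose_transpose, hX.eq, hY.eq, Matrix.mul_assoc]
    abel
  · simp [IsSymm, M3, hX.eq, Matrix.mul_assoc]
  · rw [transpose_fromRows]; simp

/-- The matrix of the map `w ↦ w ∘ f`. -/
def selectMatrix (f : Fin N → Fin (N + 1)) : Matrix (Fin N) (Fin (N + 1)) ℝ :=
  (1 : Matrix (Fin (N + 1)) (Fin (N + 1)) ℝ).submatrix f id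

theorem selectMatrix_mulVec (f : Fin N → Fin (N + 1)) (w : Fin (N + 1) → ℝ) :
    selectMatrix f *ᵥ w = w ∘ f := by
  ext i
  simp [selectMatrix, mulVec, dotProduct, one_apply]

/-- The matrix of the bilinear form `(v, w) ↦ (v ∘ f)ᵀ M (w ∘ g)`. -/
def pullback (f g : Fin N → Fin (N + 1)) (M : Matrix (Fin N) (Fin N) ℝ) :
    Matrix (Fin (N + 1)) (Fin (N + 1)) ℝ :=
  (selectMatrix f)ᵀ * M * selectMatrix g

theorem dotProduct_pullback_mulVec (f g : Fin N → Fin (N + 1)) (M : Matrix (Fin N) (Fin N) ℝ)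
    (v w : Fin (N + 1) → ℝ) :
    v ⬝ᵥ pullback f g M *ᵥ w = (v ∘ f) ⬝ᵥ M *ᵥ (w ∘ g) := by
  rw [pullback, ← mulVec_mulVec, ← mulVec_mulVec, dotProduct_mulVec, vecMul_transpose,
    selectMatrix_mulVec, selectMatrix_mulVec]

theorem transpose_pullback (f g : Fin N → Fin (N + 1)) (M : Matrix (Fin N) (Fin N) ℝ) :
    (pullback f g M)ᵀ = pullback g f Mᵀ := by
  simp [pullback, Matrix.mul_assoc]

theorem trigForm_pullback (f g : Fin N → Fin (N + 1)) (M : Matrix (Fin N) (Fin N) ℝ) (ω : ℝ) :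
    trigForm (pullback f g M) ω =
      ∑ i, ∑ j, M i j * Real.cos ((((f i : ℕ) : ℝ) - ((g j : ℕ) : ℝ)) * ω) := by
  rw [trigForm_eq_quadratic, dotProduct_pullback_mulVec, dotProduct_pullback_mulVec]
  simp only [dotProduct, mulVec, Finset.mul_sum, ← Finset.sum_add_distrib, Function.comp_apply]
  refine Finset.sum_congr rfl fun i _ => Finset.sum_congr rfl fun j _ => ?_
  rw [sub_mul, Real.cos_sub]; ring

theorem trigForm_pullback_succ (M : Matrix (Fin N) (Fin N) ℝ) (ω : ℝ) :
    trigForm (pullback Fin.succ Fin.succ M) ω = trigForm M ω := by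
  rw [trigForm_pullback]; simp [trigForm]

theorem trigForm_pullback_castSucc (M : Matrix (Fin N) (Fin N) ℝ) (ω : ℝ) :
    trigForm (pullback Fin.castSucc Fin.castSucc M) ω = trigForm M ω := by
  rw [trigForm_pullback]; simp [trigForm]

/-- The matrix of the frequency constraint multiplied by `Y`. -/
def bandMatrix (Ω : ℝ) (Y : Matrix (Fin N) (Fin N) ℝ) : Matrix (Fin (N + 1)) (Fin (N + 1)) ℝ :=
  pullback Fin.succ Fin.castSucc Y + pullback Fin.castSucc Fin.succ Y -
    (2 * Real.cos Ω) • pullback Fin.castSucc Fin.castSucc Y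

/-- The two mixed shifts change `i - j` by `±1`, and `cos (θ + ω) + cos (θ - ω) = 2 cos θ cos ω`. -/
theorem trigForm_bandMatrix (Ω : ℝ) (Y : Matrix (Fin N) (Fin N) ℝ) (ω : ℝ) :
    trigForm (bandMatrix Ω Y) ω = (2 * Real.cos ω - 2 * Real.cos Ω) * trigForm Y ω := by
  rw [bandMatrix, trigForm_sub, trigForm_add, trigForm_smul, trigForm_pullback_castSucc,
    trigForm_pullback, trigForm_pullback, sub_mul, ← Finset.sum_add_distrib]
  congr 1
  simp only [← Finset.sum_add_distrib, trigForm, Finset.mul_sum]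
  refine Finset.sum_congr rfl fun i _ => Finset.sum_congr rfl fun j _ => ?_
  have h1 : (((i.succ : ℕ) : ℝ) - ((j.castSucc : ℕ) : ℝ)) * ω = ((i : ℝ) - j) * ω + ω := by
    simp; ring
  have h2 : (((i.castSucc : ℕ) : ℝ) - ((j.succ : ℕ) : ℝ)) * ω = ((i : ℝ) - j) * ω - ω := by
    simp; ring
  rw [h1, h2, Real.cos_add, Real.cos_sub]; ring

theorem isSymm_bandMatrix (Ω : ℝ) {Y : Matrix (Fin N) (Fin N) ℝ} (hY : Y.IsSymm) :
    (bandMatrix Ω Y).IsSymm := by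
  simp only [IsSymm, bandMatrix, transpose_sub, transpose_add, transpose_smul, transpose_pullback,
    hY.eq]
  abel

/-- The matrix `γ² eₗ eₗᵀ - c cᵀ`, `eₗ` the last basis vector and `c = [C(α), 1]`. -/
def gainMatrix (α : Fin (N + 1) → ℝ) (γ : ℝ) : Matrix (Fin (N + 1)) (Fin (N + 1)) ℝ :=
  γ ^ 2 • vecMulVec (Pi.single (Fin.last N) 1) (Pi.single (Fin.last N) 1) -
    vecMulVec (augCoeff α) (augCoeff α)

theorem isSymm_gainMatrix (α : Fin (N + 1) → ℝ) (γ : ℝ) : (gainMatrix α γ).IsSymm := by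
  simp [IsSymm, gainMatrix, transpose_vecMulVec]

theorem dotProduct_gainMatrix_mulVec (α : Fin (N + 1) → ℝ) (γ : ℝ) (w : Fin (N + 1) → ℝ) :
    w ⬝ᵥ gainMatrix α γ *ᵥ w = γ ^ 2 * w (Fin.last N) ^ 2 - (augCoeff α ⬝ᵥ w) ^ 2 := by
  simp [gainMatrix, sub_mulVec, smul_mulVec, vecMulVec_mulVec, dotProduct_comm w (augCoeff α)]
  ring

theorem trigForm_gainMatrix (α : Fin (N + 1) → ℝ) (hα : α 0 = 0) (γ ω : ℝ) :
    trigForm (gainMatrix α γ) ω =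
      γ ^ 2 - ‖1 + firFilter α (Complex.exp (Complex.I * (ω : ℂ)))‖ ^ 2 := by
  have hsingle : trigForm (vecMulVec (Pi.single (Fin.last N) (1 : ℝ))
      (Pi.single (Fin.last N) 1)) ω = 1 := by
    rw [trigForm_vecMulVec]
    simp [Pi.single_apply, Real.cos_sq_add_sin_sq]
  rw [gainMatrix, trigForm_sub, trigForm_smul, hsingle, ← normSq_sum_exp, mul_one,
    mul_comm Complex.I]
  set z := Complex.exp (ω * Complex.I) with hz
  have hz0 : z ≠ 0 := Complex.exp_ne_zero _
  have hz1 : ‖z‖ = 1 := Complex.norm_exp_ofReal_mul_I ω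
  have hfir : firFilter α z =
      ∑ k : Fin N, (α (Fin.rev k.castSucc) : ℂ) * z ^ (-((Fin.rev k.castSucc : ℕ) : ℤ)) := by
    rw [firFilter, ← Equiv.sum_comp Fin.revPerm, Fin.sum_univ_castSucc]
    simp [hα]
  -- The reversed order of `C(α)` clears the negative powers; the factor `z ^ N` has modulus one.
  have key : ∑ k : Fin (N + 1), (augCoeff α k : ℂ) * z ^ (k : ℕ) =
      z ^ N * (1 + firFilter α z) := by
    rw [hfir, Fin.sum_univ_castSucc, mul_add, Finset.mul_sum, add_comm]
    simp only [augCoeff, Fin.snoc_castSucc, Fin.snoc_last, Fin.val_castSucc, Fin.val_last,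
      Complex.ofReal_one, one_mul, mul_one]
    congr 1
    refine Finset.sum_congr rfl fun k _ => ?_
    have hk : z ^ N = z ^ (k : ℕ) * z ^ (Fin.rev k.castSucc : ℕ) := by
      rw [← pow_add]
      congr 1
      simp only [Fin.val_rev, Fin.val_castSucc]; omega
    rw [hk, _root_.zpow_neg, zpow_natCast]
    have := pow_ne_zero (Fin.rev k.castSucc : ℕ) hz0
    field_simp
  rw [key, norm_mul, norm_pow, hz1, one_pow, one_mul]

theorem negDef_lmiMatrix_iff (α : Fin (N + 1) → ℝ) (Ω γ : ℝ)
    {X Y : Matrix (Fin N) (Fin N) ℝ} (hX : X.IsSymm) (hY : Y.IsSymm) :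
    NegDef (lmiMatrix α Ω γ X Y) ↔ ∀ w : Fin (N + 1) → ℝ, w ≠ 0 →
      w ⬝ᵥ (pullback Fin.succ Fin.succ X - pullback Fin.castSucc Fin.castSucc X +
        bandMatrix Ω Y - gainMatrix α γ) *ᵥ w < 0 := by
  have hform : ∀ (w : Fin (N + 1) → ℝ) (t : ℝ),
      Sum.elim (Sum.elim (Fin.init w) fun _ => w (Fin.last N)) (fun _ => t) ⬝ᵥ
        lmiMatrix α Ω γ X Y *ᵥ
          Sum.elim (Sum.elim (Fin.init w) fun _ => w (Fin.last N)) (fun _ => t) =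
      w ⬝ᵥ (pullback Fin.succ Fin.succ X - pullback Fin.castSucc Fin.castSucc X +
        bandMatrix Ω Y - gainMatrix α γ) *ᵥ w - (t - augCoeff α ⬝ᵥ w) ^ 2 := fun w t => by
    have hcomm : Fin.init w ⬝ᵥ Y *ᵥ Fin.tail w = Fin.tail w ⬝ᵥ Y *ᵥ Fin.init w := by
      rw [dotProduct_mulVec, ← mulVec_transpose, hY.eq, dotProduct_comm]
    have hi : w ∘ Fin.castSucc = Fin.init w := rfl
    have ht : w ∘ Fin.succ = Fin.tail w := rfl
    rw [dotProduct_lmiMatrix_mulVec α Ω γ hX hY, bandMatrix]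
    simp only [sub_mulVec, add_mulVec, smul_mulVec, dotProduct_sub, dotProduct_add,
      dotProduct_smul, dotProduct_pullback_mulVec, dotProduct_gainMatrix_mulVec, hi, ht, hcomm,
      smul_eq_mul]
    ring
  rw [NegDef, posDef_iff_dotProduct_mulVec]
  constructor
  · rintro ⟨-, h⟩ w hw
    -- The choice `t = augCoeff α ⬝ᵥ w` makes the completed square vanish.
    have := @h (Sum.elim (Sum.elim (Fin.init w) fun _ => w (Fin.last N))
      (fun _ => augCoeff α ⬝ᵥ w)) fun h0 => hw <| funext fun k => by
        induction k using Fin.lastCases with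
        | last => exact congrFun h0 (Sum.inl (Sum.inr 0))
        | cast i => exact congrFun h0 (Sum.inl (Sum.inl i))
    rw [star_trivial, neg_mulVec, dotProduct_neg, hform, sub_self] at this
    linarith
  · refine fun h => ⟨?_, fun x hx => ?_⟩
    · rw [IsHermitian, conjTranspose_eq_transpose_of_trivial, transpose_neg,
        (isSymm_lmiMatrix α Ω γ hX hY).eq]
    · obtain ⟨w, t, rfl⟩ : ∃ (w : Fin (N + 1) → ℝ) (t : ℝ),
          x = Sum.elim (Sum.elim (Fin.init w) fun _ => w (Fin.last N)) (fun _ => t) := by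
        refine ⟨Fin.snoc (fun i => x (Sum.inl (Sum.inl i))) (x (Sum.inl (Sum.inr 0))),
          x (Sum.inr 0), ?_⟩
        ext ((i | i) | i)
        · simp
        · simp [Subsingleton.elim i 0]
        · simp [Subsingleton.elim i 0]
      rw [star_trivial, neg_mulVec, dotProduct_neg, hform]
      by_cases hw : w = 0
      · subst hw
        have ht : t ≠ 0 := by
          rintro rfl
          refine hx (funext ?_)
          rintro ((i | i) | i) <;> rfl
        simpa using pow_pos (abs_pos.2 ht) 2
      · have := h w hw
        nlinarith [sq_nonneg (t - augCoeff α ⬝ᵥ w)]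

end quadratic

/-! ### Solving for `X` -/

section displacement

/-- Partial sums of a double sequence along its diagonals. -/
def diagSum (g : ℕ → ℕ → ℝ) : ℕ → ℕ → ℝ
  | 0, j => g 0 j
  | i + 1, 0 => g (i + 1) 0
  | i + 1, j + 1 => diagSum g i j + g (i + 1) (j + 1)

theorem diagSum_add_left (g : ℕ → ℕ → ℝ) (d b : ℕ) :
    diagSum g (d + b) b = ∑ k ∈ Finset.range (b + 1), g (d + k) k := by
  induction b with
  | zero => cases d <;> simp [diagSum]
  | succ b ih => rw [Finset.sum_range_succ, ← ih, ← add_assoc, diagSum]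

theorem diagSum_comm {g : ℕ → ℕ → ℝ} (hg : ∀ i j, g i j = g j i) (i j : ℕ) :
    diagSum g i j = diagSum g j i := by
  induction i generalizing j with
  | zero => cases j <;> simp [diagSum, hg]
  | succ i ih =>
    cases j with
    | zero => simp [diagSum, hg]
    | succ j => simp [diagSum, ih j, hg (i + 1)]

variable {N : ℕ}

theorem sum_exp_eq_trigForm {G : Matrix (Fin N) (Fin N) ℝ} (hG : G.IsSymm) (ω : ℝ) :
    ∑ a, ∑ b, (G a b : ℂ) * Complex.exp (((a : ℂ) - (b : ℂ)) * ω * Complex.I) =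
      (trigForm G ω : ℂ) := by
  have hexp : ∀ a b : Fin N, Complex.exp (((a : ℂ) - (b : ℂ)) * ω * Complex.I) =
      Real.cos (((a : ℝ) - (b : ℝ)) * ω) + Real.sin (((a : ℝ) - (b : ℝ)) * ω) * Complex.I :=
    fun a b => by rw [Complex.exp_mul_I]; push_cast; rfl
  have hsin : ∑ a, ∑ b, G a b * Real.sin (((a : ℝ) - (b : ℝ)) * ω) = 0 := by
    have h : ∑ a, ∑ b, G a b * Real.sin (((a : ℝ) - (b : ℝ)) * ω) =
        -∑ a, ∑ b, G a b * Real.sin (((a : ℝ) - (b : ℝ)) * ω) := by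
      conv_lhs => rw [Finset.sum_comm]
      simp only [← Finset.sum_neg_distrib]
      refine Finset.sum_congr rfl fun a _ => Finset.sum_congr rfl fun b _ => ?_
      rw [hG.apply a b, ← neg_sub, neg_mul, Real.sin_neg, mul_neg]
    linarith
  have hsin' : ∑ a, ∑ b, (G a b : ℂ) * Real.sin (((a : ℝ) - (b : ℝ)) * ω) = 0 := by
    exact_mod_cast hsin
  simp only [hexp, mul_add, Finset.sum_add_distrib, ← mul_assoc, ← Finset.sum_mul, hsin', zero_mul,
    add_zero]
  simp [trigForm]

/-- If the cosine polynomial of a symmetric matrix vanishes identically, then the entries on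
each of its diagonals sum to zero. -/
theorem sum_diagonal_eq_zero {G : Matrix (Fin (N + 1)) (Fin (N + 1)) ℝ} (hG : G.IsSymm)
    (h : ∀ ω, trigForm G ω = 0) (d : ℕ) :
    ∑ a : Fin (N + 1), ∑ b : Fin (N + 1), (if (a : ℕ) = d + b then G a b else 0) = 0 := by
  -- `W` is `z ^ N ∑ G a b z ^ (a - b)`. It vanishes on the unit circle, hence identically, and its
  -- coefficient at `N + d` is the sum along diagonal `d`.
  set W : ℂ[X] := ∑ a : Fin (N + 1), ∑ b : Fin (N + 1),
    monomial ((a : ℕ) + (N - b)) (G a b : ℂ) with hW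
  have hroot : ∀ z : Circle, W.IsRoot z := fun z => by
    set ω := Complex.arg z
    have hz : (z : ℂ) = Complex.exp (ω * Complex.I) := by
      have := Complex.norm_mul_exp_arg_mul_I (z : ℂ)
      rw [Circle.norm_coe, Complex.ofReal_one, one_mul] at this
      exact this.symm
    have : W.eval (z : ℂ) = (z : ℂ) ^ N * (trigForm G ω : ℂ) := by
      rw [← sum_exp_eq_trigForm hG, hW, eval_finsetSum, Finset.mul_sum]
      refine Finset.sum_congr rfl fun a _ => ?_
      rw [eval_finsetSum, Finset.mul_sum]
      refine Finset.sum_congr rfl fun b _ => ?_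
      rw [eval_monomial, hz, ← Complex.exp_nat_mul, ← Complex.exp_nat_mul,
        mul_left_comm (Complex.exp _), ← Complex.exp_add]
      congr 2
      have hb : (b : ℕ) ≤ N := by omega
      push_cast [Nat.cast_sub hb]
      ring
    rw [IsRoot, this, h]; simp
  have hinf : Infinite Circle :=
    Circle.argEquiv.infinite_iff.2 (Set.Ioc_infinite (by linarith [Real.pi_pos])).to_subtype
  have hW0 : W = 0 := eq_zero_of_infinite_isRoot W
    (Set.infinite_of_injective_forall_mem (α := Circle) Circle.coe_injective hroot)
  have hcoeff := congrArg (fun q : ℂ[X] => q.coeff (N + d)) hW0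
  simp only [hW, finsetSum_coeff, coeff_monomial, coeff_zero] at hcoeff
  have : ∑ a : Fin (N + 1), ∑ b : Fin (N + 1),
      (if (a : ℕ) = d + b then (G a b : ℂ) else 0) = 0 := by
    refine Eq.trans ?_ hcoeff
    refine Finset.sum_congr rfl fun a _ => Finset.sum_congr rfl fun b _ => ?_
    exact if_congr (by omega) rfl rfl
  apply Complex.ofReal_injective
  simpa [apply_ite] using this

/-- A symmetric matrix whose cosine polynomial vanishes is a displacement `X ↦ FᵀXF - JᵀXJ`. -/
theorem exists_displacement {G : Matrix (Fin (N + 1)) (Fin (N + 1)) ℝ} (hG : G.IsSymm)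
    (h : ∀ ω, trigForm G ω = 0) :
    ∃ X : Matrix (Fin N) (Fin N) ℝ, X.IsSymm ∧ ∀ w : Fin (N + 1) → ℝ,
      w ⬝ᵥ (pullback Fin.succ Fin.succ X - pullback Fin.castSucc Fin.castSucc X) *ᵥ w =
        w ⬝ᵥ G *ᵥ w := by
  let g : ℕ → ℕ → ℝ := fun i j =>
    if hij : i < N + 1 ∧ j < N + 1 then G ⟨i, hij.1⟩ ⟨j, hij.2⟩ else 0
  have hgG : ∀ i j : Fin (N + 1), g i j = G i j := fun i j => dif_pos ⟨i.2, j.2⟩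
  have hg : ∀ i j, g i j = g j i := fun i j => by
    simp only [g, and_comm (a := i < N + 1)]
    split_ifs
    · exact hG.apply _ _
    · rfl
  -- In the last row the partial sum runs over a complete diagonal, so it vanishes.
  have hlast : ∀ j ≤ N, diagSum g N j = 0 := fun j hj => by
    obtain ⟨d, rfl⟩ := Nat.exists_eq_add_of_le' hj
    rw [diagSum_add_left, ← sum_diagonal_eq_zero hG h d, Finset.sum_comm,
      Finset.sum_subset (Finset.range_mono (by omega : j + 1 ≤ d + j + 1)), Finset.sum_range]
    · refine Finset.sum_congr rfl fun b _ => ?_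
      by_cases hb : d + b < d + j + 1
      · rw [Finset.sum_eq_single ⟨d + b, hb⟩]
        · rw [if_pos rfl, ← hgG]
        · exact fun a _ ha => if_neg fun e => ha (Fin.ext e)
        · simp
      · rw [Finset.sum_eq_zero fun a _ => if_neg (by omega)]
        exact dif_neg (by omega)
    · intro k _ hk
      rw [Finset.mem_range] at hk
      exact dif_neg (by omega)
  have hlast' : ∀ j ≤ N, diagSum g j N = 0 := fun j hj => by
    rw [diagSum_comm hg, hlast j hj]
  -- Entrywise the equation reads `X (i-1) (j-1) - X i j = G i j`, with `X` zero outside its range;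
  -- negated diagonal sums solve it, and `hlast`, `hlast'` are the boundary conditions at index `N`.
  refine ⟨of fun i j => -diagSum g i j, ?_, fun w => ?_⟩
  · ext i j
    simp [diagSum_comm hg (i : ℕ) j]
  rw [sub_mulVec, dotProduct_sub, dotProduct_pullback_mulVec, dotProduct_pullback_mulVec]
  have hJ : (w ∘ Fin.castSucc) ⬝ᵥ (of fun i j : Fin N => -diagSum g i j) *ᵥ (w ∘ Fin.castSucc) =
      -∑ i : Fin (N + 1), ∑ j : Fin (N + 1), w i * (diagSum g i j * w j) := by
    have h1 : ∀ i : Fin N, diagSum g i N = 0 := fun i => hlast' i i.2.le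
    have h2 : ∀ j : Fin (N + 1), diagSum g N j = 0 := fun j => hlast j (Nat.lt_succ_iff.1 j.2)
    rw [Fin.sum_univ_castSucc]
    simp only [Fin.val_last, h2, zero_mul, mul_zero, Finset.sum_const_zero, add_zero]
    simp [dotProduct, mulVec, Fin.sum_univ_castSucc, Finset.mul_sum, h1]
  have hF : (w ∘ Fin.succ) ⬝ᵥ (of fun i j : Fin N => -diagSum g i j) *ᵥ (w ∘ Fin.succ) =
      -∑ i : Fin (N + 1), ∑ j : Fin (N + 1), w i * ((diagSum g i j - g i j) * w j) := by
    have h1 : ∀ i, diagSum g i 0 = g i 0 := fun i => by cases i <;> rfl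
    have h2 : ∀ j, diagSum g 0 j = g 0 j := fun j => by simp [diagSum]
    rw [Fin.sum_univ_succ]
    simp only [Fin.val_zero, h2, sub_self, zero_mul, mul_zero, Finset.sum_const_zero, zero_add]
    simp [dotProduct, mulVec, Fin.sum_univ_succ, Finset.mul_sum, h1, diagSum]
  rw [hJ, hF, sub_neg_eq_add, neg_add_eq_sub, ← Finset.sum_sub_distrib]
  simp only [dotProduct, mulVec, Finset.mul_sum, ← Finset.sum_sub_distrib, hgG]
  refine Finset.sum_congr rfl fun i _ => Finset.sum_congr rfl fun j _ => ?_
  ring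

end displacement

/-! ### The two implications -/

variable {N : ℕ}

theorem norm_lt_of_negDef_lmiMatrix (α : Fin (N + 1) → ℝ) (hα : α 0 = 0) {Ω γ : ℝ}
    (hΩ : Ω ≤ Real.pi) (hγ : 0 ≤ γ) {X Y : Matrix (Fin N) (Fin N) ℝ} (hX : X.IsSymm)
    (hY : Y.IsSymm) (hY' : Y.PosSemidef) (h : NegDef (lmiMatrix α Ω γ X Y)) {ω : ℝ}
    (hω : ω ∈ Set.Icc 0 Ω) :
    ‖1 + firFilter α (Complex.exp (Complex.I * (ω : ℂ)))‖ < γ := by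
  rw [negDef_lmiMatrix_iff α Ω γ hX hY] at h
  have hY0 : 0 ≤ trigForm Y ω := by
    rw [trigForm_eq_quadratic]
    exact add_nonneg (by simpa using hY'.dotProduct_mulVec_nonneg _)
      (by simpa using hY'.dotProduct_mulVec_nonneg _)
  set K := pullback Fin.succ Fin.succ X - pullback Fin.castSucc Fin.castSucc X +
    bandMatrix Ω Y - gainMatrix α γ with hK
  have hneg : trigForm K ω < 0 := by
    rw [trigForm_eq_quadratic]
    -- The cosine vector has first entry 1, so it is nonzero; the sine vector may vanish, as at `ω =
    -- 0`.
    refine add_neg_of_neg_of_nonpos (h _ fun h0 => ?_) ?_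
    · simpa using congrFun h0 0
    · set s : Fin (N + 1) → ℝ := fun k => Real.sin (k * ω)
      by_cases hs : s = 0
      · simp [hs]
      · exact (h s hs).le
  have hcos : Real.cos Ω ≤ Real.cos ω := Real.cos_le_cos_of_nonneg_of_le_pi hω.1 hΩ hω.2
  rw [hK, trigForm_sub, trigForm_add, trigForm_sub, trigForm_pullback_succ,
    trigForm_pullback_castSucc, trigForm_bandMatrix, trigForm_gainMatrix α hα] at hneg
  have := mul_nonneg (by linarith : 0 ≤ 2 * Real.cos ω - 2 * Real.cos Ω) hY0
  exact lt_of_pow_lt_pow_left₀ 2 hγ (by linarith)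

/-- A positive polynomial on `[c, 1]` stays positive after subtracting a small positive
multiple of any other polynomial. -/
theorem exists_pos_sub_on_Icc {c : ℝ} (hc : c ≤ 1) (p : ℝ[X]) (r : ℝ[X])
    (hp : ∀ t ∈ Set.Icc c 1, 0 < p.eval t) :
    ∃ ε > 0, ∀ t ∈ Set.Icc c 1, 0 < (p - C ε * r).eval t := by
  obtain ⟨t₀, ht₀, hmin⟩ := isCompact_Icc.exists_isMinOn (Set.nonempty_Icc.2 hc)
    p.continuous.continuousOn
  obtain ⟨b, hb⟩ := isCompact_Icc.exists_bound_of_continuousOn (s := Set.Icc c 1)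
    r.continuous.continuousOn
  have hb0 : 0 ≤ b := (norm_nonneg _).trans (hb t₀ ht₀)
  have hδ := hp t₀ ht₀
  refine ⟨p.eval t₀ / (b + 1), by positivity, fun t ht => ?_⟩
  have h1 : p.eval t₀ ≤ p.eval t := hmin ht
  have h2 : r.eval t < b + 1 := by
    linarith [le_abs_self (r.eval t), hb t ht, Real.norm_eq_abs (r.eval t)]
  have h3 : p.eval t₀ / (b + 1) * r.eval t < p.eval t₀ / (b + 1) * (b + 1) := by gcongr
  rw [div_mul_cancel₀ _ (by positivity)] at h3
  simp only [eval_sub, eval_mul, eval_C]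
  linarith

theorem exists_negDef_lmiMatrix (α : Fin (N + 1) → ℝ) (hα : α 0 = 0) {Ω γ : ℝ}
    (h : ∀ ω ∈ Set.Icc 0 Ω, ‖1 + firFilter α (Complex.exp (Complex.I * (ω : ℂ)))‖ < γ)
    (hΩ0 : 0 ≤ Ω) (hΩ : Ω ≤ Real.pi) :
    ∃ X Y : Matrix (Fin N) (Fin N) ℝ,
      X.IsSymm ∧ Y.IsSymm ∧ Y.PosDef ∧ NegDef (lmiMatrix α Ω γ X Y) := by
  obtain ⟨p, hpd, hp⟩ := exists_polynomial_trigForm (gainMatrix α γ)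
  set c := Real.cos Ω with hc
  have hc1 : c ≤ 1 := Real.cos_le_one Ω
  have hpos : ∀ t ∈ Set.Icc c 1, 0 < p.eval t := fun t ht => by
    have ht1 : -1 ≤ t := (Real.neg_one_le_cos Ω).trans ht.1
    have hω : Real.arccos t ∈ Set.Icc 0 Ω := by
      refine ⟨Real.arccos_nonneg t, ?_⟩
      rw [← Real.arccos_cos hΩ0 hΩ]
      exact Real.arccos_le_arccos ht.1
    rw [← Real.cos_arccos ht1 ht.2, ← hp, trigForm_gainMatrix α hα, sub_pos]
    exact pow_lt_pow_left₀ (h _ hω) (norm_nonneg _) two_ne_zero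
  -- `r (cos ω)` is the cosine polynomial of the identity plus the weight times that of the smaller
  -- identity: the cost of adding `ε • 1` to both Gram matrices.
  set r : ℝ[X] := C ((N : ℝ) + 1) + C (N : ℝ) * (2 * X - C (2 * c)) with hr
  have hrd : r.degree ≤ N := by
    rcases Nat.eq_zero_or_pos N with rfl | hN
    · simp only [hr, Nat.cast_zero, C_0, zero_mul, add_zero]
      exact degree_C_le
    · have : r.degree ≤ (1 : ℕ) := by rw [hr]; compute_degree; norm_num
      exact this.trans (by exact_mod_cast hN)
  obtain ⟨ε, hε, hε'⟩ := exists_pos_sub_on_Icc hc1 p r hpos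
  have hdeg : (p - C ε * r).natDegree ≤ N := by
    refine natDegree_le_iff_degree_le.2 ((degree_sub_le _ _).trans (max_le hpd ?_))
    rw [← smul_eq_C_mul]
    exact (degree_smul_le _ _).trans hrd
  obtain ⟨f₀, hf₀, f₁, hf₁, hf⟩ := isIntervalSOS_of_pos_on_Icc hc1 N _ hdeg hε'
  obtain ⟨P₀, hP₀, hfP⟩ := exists_posSemidef_of_mem_sosCone hf₀
  obtain ⟨Y₀, hY₀, hfY⟩ := exists_posSemidef_of_mem_sosCone hf₁
  have hP : (P₀ + ε • (1 : Matrix _ _ ℝ)).PosDef := (PosDef.one.smul hε).posSemidef_add hP₀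
  have hY : (Y₀ + ε • (1 : Matrix _ _ ℝ)).PosDef := (PosDef.one.smul hε).posSemidef_add hY₀
  set P := P₀ + ε • (1 : Matrix (Fin (N + 1)) (Fin (N + 1)) ℝ) with hPdef
  set Y := Y₀ + ε • (1 : Matrix (Fin N) (Fin N) ℝ) with hYdef
  have hPs : P.IsSymm := hP.1
  have hYs : Y.IsSymm := hY.1
  have hG : (gainMatrix α γ - P - bandMatrix Ω Y).IsSymm :=
    ((isSymm_gainMatrix α γ).sub hPs).sub (isSymm_bandMatrix Ω hYs)
  obtain ⟨X, hX, hXG⟩ := exists_displacement hG fun ω => by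
    rw [trigForm_sub, trigForm_sub, trigForm_bandMatrix, hPdef, hYdef, trigForm_add, trigForm_add,
      trigForm_smul, trigForm_smul, trigForm_one, trigForm_one, ← hfP, ← hfY, hp]
    have := hf ω
    simp only [hr, eval_sub, eval_add, eval_mul, eval_C, eval_X, eval_ofNat] at this
    push_cast
    linear_combination this
  refine ⟨X, Y, hX, hYs, hY, (negDef_lmiMatrix_iff α Ω γ hX hYs).2 fun w hw => ?_⟩
  have hpw := hP.dotProduct_mulVec_pos hw
  rw [star_trivial] at hpw
  have := hXG w
  simp only [sub_mulVec, add_mulVec, dotProduct_sub, dotProduct_add] at this ⊢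
  linarith

end

end DeltaSigma

theorem theorem1 (N : ℕ) (α : Fin (N + 1) → ℝ) (hα : α 0 = 0)
    (Ω : ℝ) (hΩ_pos : 0 < Ω) (hΩ_lt : Ω < Real.pi) (γ : ℝ) (hγ : 0 ≤ γ) :
    (∃ m : ℝ,
        IsGreatest
          ((fun ω : ℝ => ‖1 + DeltaSigma.firFilter α (Complex.exp (Complex.I * (ω : ℂ)))‖) ''
            Set.Icc 0 Ω) m ∧
        m < γ) ↔
      ∃ X Y : Matrix (Fin N) (Fin N) ℝ,
        X.IsSymm ∧ Y.IsSymm ∧ Y.PosDef ∧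
          DeltaSigma.NegDef (DeltaSigma.lmiMatrix α Ω γ X Y) := by
  constructor
  · rintro ⟨m, hm, hmγ⟩
    exact DeltaSigma.exists_negDef_lmiMatrix α hα
      (fun ω hω => (hm.2 (Set.mem_image_of_mem _ hω)).trans_lt hmγ) hΩ_pos.le hΩ_lt.le
  · rintro ⟨X, Y, hX, hY, hY', h⟩
    -- Continuity on the compact interval supplies the attained maximum.
    have hcont : Continuous fun ω : ℝ =>
        ‖1 + DeltaSigma.firFilter α (Complex.exp (Complex.I * (ω : ℂ)))‖ := by
      unfold DeltaSigma.firFilter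
      refine (continuous_const.add (continuous_finsetSum _ fun k _ => continuous_const.mul ?_)).norm
      exact Continuous.zpow₀ (by fun_prop) _ fun _ => Or.inl (Complex.exp_ne_zero _)
    obtain ⟨ω, hω, hmax⟩ := isCompact_Icc.exists_isMaxOn
      (Set.nonempty_Icc.2 hΩ_pos.le) hcont.continuousOn
    refine ⟨_, ⟨Set.mem_image_of_mem _ hω, ?_⟩,
      DeltaSigma.norm_lt_of_negDef_lmiMatrix α hα hΩ_lt.le hγ hX hY hY'.posSemidef h hω⟩
    rintro _ ⟨ω', hω', rfl⟩
    exact hmax hω'
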